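/- **Setting.** Let $L,\nu>0$, $\Omega=[0,L]^3$ the periodic box, $\lambda_1=4\pi^2/L^2$. For $s=0,1,2$ let $\dot V_s$ be the space of real, mean-free, divergence-free fields $u(x)=\sum_{K\in\mathbb Z^3\setminus\{0\}}\hat u_Ke^{2\pi iK\cdot x/L}$ with $\|u\|_{\dot V_s}^2=L^3\sum_K(2\pi|K|/L)^{2s}|\hat u_K|^2<\infty$, and write $H=\dot V_0$, $V=\dot V_1$, $D(A)=\dot V_2$, $\|u\|=\|u\|_H$, $\|\nabla u\|=\|u\|_V$. Let $A=-\Delta$, let $\mathcal P$ be the Helmholtz–Leray projection, $B(u,v)=\mathcal P[(u\cdot\nabla)v]$, and let $P_N$ be the projection onto the Fourier modes with $0<|K|<N$. Let $f\in L^\infty([0,\infty);H)$ and write $\sup_{s\ge0}\|f(s)\|$ for its (essential) supremum norm. A solution on a time interval $I$ of $\frac{d}{dt}(u+a^2Au)+\nu A(u+a^2Au)+B(u,u)=F$ is a $u\in C(I;V)\cap L^2_{loc}(I;D(A))$ that satisfies the equation in $D(A)'=\dot V_{-2}$, integrated in time. Let $0<\alpha_0\le\alpha\le\alpha_1$, and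 let $u$ be a solution on $[0,\infty)$ of the simplified Bardina system $$\frac{dv}{dt}+\nu Av+B(u,u)=f,\qquad v=u+\alpha^2Au,$$ with $\|u(0)\|\le M_A$ and $\|\nabla u(0)\|\le M_B$. Let $n\ge1$, $0\le t_n<t_{n+1}$, $\beta_n>0$, $\eta_n>0$, $N_n\in\mathbb N$ with $N_n\ge1$, and let $w_n$ be a solution on $[t_n,t_{n+1}]$ of the nudged system $$\frac{dz_n}{dt}+\nu Az_n+B(w_n,w_n)=f-\eta_n(I+\beta_n^2A)\mathcal P(P_{N_n}w_n-P_{N_n}u),\qquad z_n=w_n+\beta_n^2Aw_n,$$ with $w_n(t_n)=w_{n-1}(t_n)$, where $w_{n-1}(t_n)$ is the final value of the previous step (for $n=1$: the prescribed initial datum). Put $$M_1^2(t)=e^{-\nu\lambda_1t}\left(M_A^2+\alpha_1^2M_B^2\right)+\frac1{\lambda_1^2\nu^2}\sup_{s\ge0}\|f(s)\|^2,$$ $$M^2_{(4,n)}(t,\eta_n)=e^{-\frac{\eta_n}2(t-t_n)}\left(\|w_{n-1}(t_n)\|^2+\beta_n^2\|\nabla w_{n-1}(t_n)\|^2\right)+\frac4{\eta_n^2}\sup_{r\ge0}\|f(r)\|^2+2\left(2+\frac{\beta_n^2}{\alpha_0^2}\right)M_1^2(t_n).$$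 **Proposition 5.4.** If $\dfrac{\eta_n}{N_n^2}\le\dfrac{\nu\lambda_1}2$, then for all $t\in[t_n,t_{n+1}]$ $$\|w_n(t)\|^2+\beta_n^2\|\nabla w_n(t)\|^2\le M^2_{(4,n)}(t,\eta_n).$$ -/

import Mathlib

open MeasureTheory Set Filter Topology

noncomputable section

namespace Bardina

/-- Wave numbers `K ∈ ℤ³`. -/
abbrev Wave : Type := Fin 3 → ℤ

/-- A (generalized) vector field on the torus `[0,L]³`, given by its Fourier coefficients:
`u(x) = ∑_K û_K e^{2πi K·x/L}` with `û_K ∈ ℂ³`.  Here `u K` is `û_K`. -/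
abbrev Field : Type := Wave → EuclideanSpace ℂ (Fin 3)

/-- `|K|²`. -/
def waveSq (K : Wave) : ℝ := ∑ j, (K j : ℝ) ^ 2

/-- The bilinear (not sesquilinear) product `a · K = ∑_j a_j K_j` for `a ∈ ℂ³`. -/
def dotWave (a : EuclideanSpace ℂ (Fin 3)) (K : Wave) : ℂ := ∑ j, a j * (K j : ℂ)

/-- `λ₁ = 4π²/L²`. -/
def lam1 (L : ℝ) : ℝ := 4 * Real.pi ^ 2 / L ^ 2

/-- The eigenvalue `4π²|K|²/L² = (2π|K|/L)²` of the Stokes operator on the mode `K`. -/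
def eig (L : ℝ) (K : Wave) : ℝ := lam1 L * waveSq K

/-- Membership in the space `V_s` of real, mean-free, divergence-free fields with
`∑_K |K|^{2s} |û_K|² < ∞`, for integers `s ≥ 0`.  So `H`, `V`, `D(A)` are the cases
`s = 0, 1, 2`. -/
structure MemV (s : ℕ) (u : Field) : Prop where
  mean_zero : u 0 = 0
  real : ∀ K j, u K j = star (u (-K) j)
  div_free : ∀ K, dotWave (u K) K = 0
  summable : Summable fun K : Wave => waveSq K ^ s * ‖u K‖ ^ 2

/-- The squared norm `L³ ∑_K (2π|K|/L)^{2s} |û_K|²` of `V_s`.  For `s = 0, 1, 2` this is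
`‖u‖²`, `‖∇u‖²`, `‖Au‖²` respectively (`L²` norms over `[0,L]³`). -/
def normSq (L : ℝ) (s : ℕ) (u : Field) : ℝ := L ^ 3 * ∑' K : Wave, eig L K ^ s * ‖u K‖ ^ 2

/-- The Stokes operator `A = -Δ`. -/
def stokes (L : ℝ) (u : Field) : Field := fun K => (eig L K : ℂ) • u K

/-- `(I + a² A) u`. -/
def helmholtz (L a : ℝ) (u : Field) : Field := u + ((a ^ 2 : ℝ) : ℂ) • stokes L u

/-- The Helmholtz–Leray projection `û_K ↦ û_K - K (û_K · K) / |K|²` for `K ≠ 0`; the mean is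
removed. -/
def leray (u : Field) : Field := fun K =>
  if K = 0 then 0
  else u K - (dotWave (u K) K / (waveSq K : ℂ)) • WithLp.toLp 2 (fun j => (K j : ℂ))

/-- The projection `P_N` onto the modes `0 < |K| < N`. -/
def lowModes (N : ℕ) (u : Field) : Field := fun K =>
  if K ≠ 0 ∧ waveSq K < (N : ℝ) ^ 2 then u K else 0

/-- The field `(u · ∇) v = ∑_j u_j ∂_j v`.  Its coefficient at `K` is the Cauchy product
`∑_J (2πi/L) (û_J · (K - J)) v̂_{K-J}` of the Fourier series of `u_j` and `∂_j v`; the sum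
converges absolutely for all `u ∈ H`, `v ∈ V`. -/
def advect (L : ℝ) (u v : Field) : Field := fun K =>
  ∑' J : Wave, (2 * Real.pi * Complex.I / L * dotWave (u J) (K - J)) • v (K - J)

/-- The bilinear operator `B(u,v) = 𝒫[(u · ∇) v]`. -/
def bilin (L : ℝ) (u v : Field) : Field := leray (advect L u v)

/-- `f ∈ L^∞([0,∞); H)`.  As `H` is separable, measurability of all Fourier coefficients is
the same as strong measurability of the `H`-valued map. -/
structure MemLinfH (L : ℝ) (f : ℝ → Field) : Prop where
  measurable : ∀ K, AEStronglyMeasurable (fun t => f t K) (volume.restrict (Ici 0))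
  mem : ∀ᵐ t ∂(volume.restrict (Ici (0 : ℝ))), MemV 0 (f t)
  bounded : MemLp (fun t => Real.sqrt (normSq L 0 (f t))) ⊤ (volume.restrict (Ici 0))

/-- `sup_{s ≥ 0} ‖f(s)‖`, the norm of `f` in `L^∞([0,∞); H)` (an essential supremum). -/
def supNorm (L : ℝ) (f : ℝ → Field) : ℝ :=
  (eLpNorm (fun t => Real.sqrt (normSq L 0 (f t))) ⊤ (volume.restrict (Ici 0))).toReal

/-- `u` is a (regular) solution, on the time interval `I`, of
`dv/dt + ν A v + B(u,u) = F`, `v = u + a² A u`, `∇·u = ∇·v = 0`: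
`u ∈ C(I; V) ∩ L²_loc(I; D(A))`, and the equation holds in `D' = V_{-2}`, that is for each
Fourier coefficient, in the form integrated over time (so `v` is absolutely continuous with
values in `D'` and the equation holds there for almost every time). -/
structure IsSolution (L ν a : ℝ) (F : ℝ → Field) (I : Set ℝ) (u : ℝ → Field) : Prop where
  mem_V : ∀ t ∈ I, MemV 1 (u t)
  continuous_V : ∀ t₀ ∈ I, Tendsto (fun t => normSq L 1 (u t - u t₀)) (𝓝[I] t₀) (𝓝 0)
  mem_DA : ∀ᵐ t ∂(volume.restrict I), MemV 2 (u t)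
  sq_integrable_DA : ∀ t₀ ∈ I, ∀ t₁ ∈ I,
    IntegrableOn (fun t => normSq L 2 (u t)) (Icc t₀ t₁)
  integrable : ∀ K, ∀ t₀ ∈ I, ∀ t₁ ∈ I, IntervalIntegrable
    (fun s => F s K - (ν : ℂ) • stokes L (helmholtz L a (u s)) K - bilin L (u s) (u s) K)
    volume t₀ t₁
  equation : ∀ K, ∀ t₀ ∈ I, ∀ t₁ ∈ I,
    helmholtz L a (u t₁) K - helmholtz L a (u t₀) K =
      ∫ s in t₀..t₁,
        (F s K - (ν : ℂ) • stokes L (helmholtz L a (u s)) K - bilin L (u s) (u s) K)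

/-- `u` solves the simplified Bardina system with length scale `α` for all times `t ≥ 0`. -/
def IsBardinaSolution (L ν α : ℝ) (f u : ℝ → Field) : Prop :=
  IsSolution L ν α f (Ici 0) u

/-- `w` solves, on the time interval `I`, the nudged Bardina system
`dz/dt + ν A z + B(w,w) = f - η (I + β² A) 𝒫 (P_N w - P_N u)`, `z = w + β² A w`. -/
def IsNudgedSolution (L ν β η : ℝ) (N : ℕ) (f u : ℝ → Field) (I : Set ℝ) (w : ℝ → Field) :
    Prop :=
  IsSolution L ν β
    (fun t => f t -
      (η : ℂ) • helmholtz L β (leray (lowModes N (w t) - lowModes N (u t)))) I w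

/-- `M₁²(t) = e^{-νλ₁t} (M_A² + α₁² M_B²) + (λ₁ν)^{-2} sup_{s≥0} ‖f(s)‖²`. -/
def M1sq (L ν α₁ MA MB : ℝ) (f : ℝ → Field) (t : ℝ) : ℝ :=
  Real.exp (-(ν * lam1 L * t)) * (MA ^ 2 + α₁ ^ 2 * MB ^ 2) +
    1 / (lam1 L ^ 2 * ν ^ 2) * supNorm L f ^ 2

/-- `M²_{(4,n)}(t,η_n)`, where `tₙ`, `β`, `η` are the data of the step `n` and
`wprev = w_{n-1}(t_n)`:
`e^{-η(t-tₙ)/2} (‖wprev‖² + β²‖∇wprev‖²) + (4/η²) sup ‖f‖² + 2 (2 + β²/α₀²) M₁²(tₙ)`. -/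
def M4sq (L ν α₀ α₁ MA MB : ℝ) (f : ℝ → Field) (tₙ β : ℝ) (wprev : Field) (t η : ℝ) : ℝ :=
  Real.exp (-(η / 2 * (t - tₙ))) * (normSq L 0 wprev + β ^ 2 * normSq L 1 wprev) +
    4 / η ^ 2 * supNorm L f ^ 2 +
    2 * (2 + β ^ 2 / α₀ ^ 2) * M1sq L ν α₁ MA MB f tₙ

end Bardina

end

/-!
On Fourier coefficients, testing the equation with `u` is a weighted balance, mode by mode, for
`(1 + a²(2π|K|/L)²) |û_K|²`, whose sum over `K` is the energy `‖u‖² + a²‖∇u‖²`. The nonlinear term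
does no work: for `u ∈ D(A)` its contribution is an absolutely convergent sum over the triads
`(K, J, K - J)`, and the substitution `K ↦ J - K` changes the sign of each summand.
Therefore, with a weight `e^{γt}`, the energy decays at the rate `γ` up to the forcing, as soon as
each mode loses at least `γ` times its own energy. For the Bardina system viscosity alone achieves
`γ = νλ₁`. For the nudged system `γ = η / 2` works: the observed modes are damped by the nudging,
the unobserved ones by viscosity because `η / 2 ≤ νλ₁N²`; the price is the energy of the observed
field `u`, which the estimate for the Bardina system controls.
-/

noncomputable section

namespace Bardina

/-! ### Calculus -/

section Calculus

lemma absolutelyContinuousOnInterval_of_dist_le {X Y : Type*} [PseudoMetricSpace X]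
    [PseudoMetricSpace Y] {f : ℝ → X} {g : ℝ → Y} {a b : ℝ}
    (hg : AbsolutelyContinuousOnInterval g a b)
    (hfg : ∀ x ∈ uIcc a b, ∀ y ∈ uIcc a b, dist (f x) (f y) ≤ dist (g x) (g y)) :
    AbsolutelyContinuousOnInterval f a b := by
  rw [absolutelyContinuousOnInterval_iff] at hg ⊢
  intro ε hε
  obtain ⟨δ, hδ, h⟩ := hg ε hε
  refine ⟨δ, hδ, fun I hI hlength => (Finset.sum_le_sum fun i hi => ?_).trans_lt (h I hI hlength)⟩
  exact hfg _ (hI.1 i hi).1 _ (hI.1 i hi).2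

lemma absolutelyContinuousOnInterval_primitive {E : Type*} [NormedAddCommGroup E]
    [NormedSpace ℝ E] {g : ℝ → E} {a b : ℝ} (hg : IntervalIntegrable g volume a b) :
    AbsolutelyContinuousOnInterval (fun t => ∫ s in a..t, g s) a b := by
  have hga : ∀ x ∈ uIcc a b, IntervalIntegrable g volume a x := fun x hx =>
    hg.mono_set (uIcc_subset_uIcc_left hx)
  refine absolutelyContinuousOnInterval_of_dist_le
    (hg.norm.absolutelyContinuousOnInterval_intervalIntegral left_mem_uIcc) fun x hx y hy => ?_
  rw [dist_eq_norm, Real.dist_eq, intervalIntegral.integral_interval_sub_left (hga x hx) (hga y hy),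
    intervalIntegral.integral_interval_sub_left (hga x hx).norm (hga y hy).norm]
  exact intervalIntegral.norm_integral_le_abs_integral_norm

lemma integral_exp_mul_deriv_norm_sq {E : Type*} [NormedAddCommGroup E] [InnerProductSpace ℝ E]
    [CompleteSpace E] {y g : ℝ → E} {a b : ℝ} (γ : ℝ) (hg : IntervalIntegrable g volume a b)
    (hy : ∀ t ∈ uIcc a b, y t - y a = ∫ s in a..t, g s) :
    IntervalIntegrable (fun s => Real.exp (γ * s) * (γ * ‖y s‖ ^ 2 + 2 * inner ℝ (y s) (g s)))
      volume a b ∧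
    ∫ s in a..b, Real.exp (γ * s) * (γ * ‖y s‖ ^ 2 + 2 * inner ℝ (y s) (g s)) =
      Real.exp (γ * b) * ‖y b‖ ^ 2 - Real.exp (γ * a) * ‖y a‖ ^ 2 := by
  let P : ℝ → E := fun t => y a + ∫ s in a..t, g s
  have hP : ∀ t ∈ uIcc a b, P t = y t := fun t ht => by simp only [P, ← hy t ht, add_sub_cancel]
  have hnorm : AbsolutelyContinuousOnInterval (fun t => ‖P t‖) a b :=
    absolutelyContinuousOnInterval_of_dist_le (absolutelyContinuousOnInterval_primitive hg)
      fun x _ y _ => (dist_norm_norm_le _ _).trans_eq (by simp only [P, add_sub_add_left_eq_sub,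
        dist_eq_norm])
  have hexp : AbsolutelyContinuousOnInterval (fun t => Real.exp (γ * t)) a b :=
    (show ContDiff ℝ 1 fun t => Real.exp (γ * t) by fun_prop).contDiffOn
      |>.absolutelyContinuousOnInterval
  have hac := hexp.fun_mul (hnorm.fun_mul hnorm)
  have hderiv : ∀ᵐ x, x ∈ uIoc a b → deriv (fun t => Real.exp (γ * t) * (‖P t‖ * ‖P t‖)) x =
      Real.exp (γ * x) * (γ * ‖y x‖ ^ 2 + 2 * inner ℝ (y x) (g x)) := by
    filter_upwards [hg.ae_hasDerivAt_integral] with x hx hxI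
    have hx' := uIoc_subset_uIcc hxI
    have hsq : HasDerivAt (fun t => ‖P t‖ ^ 2) (2 * inner ℝ (P x) (g x)) x :=
      ((hx hx' a left_mem_uIcc).const_add (y a)).norm_sq
    have hexp' : HasDerivAt (fun t => Real.exp (γ * t)) (Real.exp (γ * x) * γ) x := by
      simpa using ((hasDerivAt_id x).const_mul γ).exp
    simp only [← pow_two]
    rw [(hexp'.fun_mul hsq).deriv, hP x hx']
    ring
  refine ⟨hac.intervalIntegrable_deriv.congr_ae
    ((ae_restrict_iff' measurableSet_uIoc).mpr hderiv), ?_⟩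
  rw [← intervalIntegral.integral_congr_ae hderiv, hac.integral_deriv_eq_sub,
    hP a left_mem_uIcc, hP b right_mem_uIcc]
  ring

/-- Truncating `G i` from below by `g` gives measurable functions to which dominated convergence
applies, although nothing is known about the measurability of the errors `r i`. -/
lemma le_integral_of_tendsto_of_le_add {X ι : Type*} [MeasurableSpace X] {μ : Measure X}
    {l : Filter ι} [l.NeBot] [l.IsCountablyGenerated] {G r : ι → X → ℝ} {g b : X → ℝ} {A : ℝ}
    (hG : ∀ i, Integrable (G i) μ) (hg : Integrable g μ) (hb : Integrable b μ)
    (hle : ∀ᵐ x ∂μ, ∀ i, G i x ≤ g x + r i x) (hr : ∀ᵐ x ∂μ, ∀ i, |r i x| ≤ b x)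
    (hlim : ∀ᵐ x ∂μ, Tendsto (fun i => r i x) l (𝓝 0))
    (hA : Tendsto (fun i => ∫ x, G i x ∂μ) l (𝓝 A)) : A ≤ ∫ x, g x ∂μ := by
  have hmax : ∀ᵐ x ∂μ, ∀ i, |max (G i x) (g x) - g x| ≤ |r i x| := by
    filter_upwards [hle] with x hx i
    rw [abs_of_nonneg (sub_nonneg.mpr (le_max_right _ _)), sub_le_iff_le_add']
    exact max_le ((hx i).trans (by gcongr; exact le_abs_self _))
      (le_add_of_nonneg_right (abs_nonneg _))
  have htrunc : Tendsto (fun i => ∫ x, max (G i x) (g x) ∂μ) l (𝓝 (∫ x, g x ∂μ)) := by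
    refine tendsto_integral_filter_of_dominated_convergence (fun x => |g x| + b x)
      (Eventually.of_forall fun i => ((hG i).sup hg).aestronglyMeasurable)
      (Eventually.of_forall fun i => ?_) (hg.abs.add hb) ?_
    · filter_upwards [hmax, hr] with x hx hrx
      rw [Real.norm_eq_abs]
      linarith [hx i, hrx i, abs_sub_abs_le_abs_sub (max (G i x) (g x)) (g x)]
    · filter_upwards [hmax, hlim] with x hx hrx
      exact tendsto_iff_norm_sub_tendsto_zero.mpr
        (squeeze_zero (fun _ => norm_nonneg _) hx (tendsto_zero_iff_norm_tendsto_zero.mp hrx))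
  exact le_of_tendsto_of_tendsto' hA htrunc fun i =>
    integral_mono (hG i) ((hG i).sup hg) fun x => le_max_left _ _

end Calculus

/-! ### Wave numbers and norms -/

lemma waveSq_nonneg (K : Wave) : 0 ≤ waveSq K := Finset.sum_nonneg fun _ _ => sq_nonneg _

lemma one_le_waveSq {K : Wave} (hK : K ≠ 0) : 1 ≤ waveSq K := by
  obtain ⟨j, hj⟩ := Function.ne_iff.mp hK
  calc (1 : ℝ) ≤ (K j : ℝ) ^ 2 := by
        exact_mod_cast (one_le_sq_iff_one_le_abs (K j)).mpr (Int.one_le_abs hj)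
    _ ≤ waveSq K := Finset.single_le_sum (f := fun j => (K j : ℝ) ^ 2)
        (fun _ _ => sq_nonneg _) (Finset.mem_univ j)

lemma lam1_pos {L : ℝ} (hL : 0 < L) : 0 < lam1 L := by unfold lam1; positivity

lemma eig_nonneg {L : ℝ} (hL : 0 < L) (K : Wave) : 0 ≤ eig L K :=
  mul_nonneg (lam1_pos hL).le (waveSq_nonneg K)

lemma lam1_le_eig {L : ℝ} (hL : 0 < L) {K : Wave} (hK : K ≠ 0) : lam1 L ≤ eig L K :=
  le_mul_of_one_le_right (lam1_pos hL).le (one_le_waveSq hK)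

lemma norm_dotWave_le (a : EuclideanSpace ℂ (Fin 3)) (K : Wave) :
    ‖dotWave a K‖ ≤ ‖a‖ * √(waveSq K) := by
  calc ‖dotWave a K‖ ≤ ∑ j, ‖a j‖ * |(K j : ℝ)| := by
        simpa only [dotWave, norm_mul, Complex.norm_intCast] using norm_sum_le Finset.univ
          fun j => a j * (K j : ℂ)
    _ ≤ √(∑ j, ‖a j‖ ^ 2) * √(∑ j, |(K j : ℝ)| ^ 2) := Real.sum_mul_le_sqrt_mul_sqrt _ _ _
    _ = ‖a‖ * √(waveSq K) := by simp only [EuclideanSpace.norm_eq, sq_abs, waveSq]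

lemma dotWave_sub (a : EuclideanSpace ℂ (Fin 3)) (K J : Wave) :
    dotWave a (K - J) = dotWave a K - dotWave a J := by
  simp [dotWave, mul_sub, Finset.sum_sub_distrib]

lemma dotWave_neg (a : EuclideanSpace ℂ (Fin 3)) (K : Wave) :
    dotWave a (-K) = -dotWave a K := by
  simp [dotWave]

lemma summable_inv_waveSq_sq : Summable fun K : Wave => (waveSq K ^ 2)⁻¹ := by
  let b := (EuclideanSpace.basisFun (Fin 3) ℝ).toBasis
  let Λ : Submodule ℤ (EuclideanSpace ℝ (Fin 3)) := Submodule.span ℤ (Set.range b)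
  have hrank : Module.finrank ℤ Λ < 4 := by simp [ZLattice.rank ℝ Λ]
  let e : Wave → Λ := fun K => ⟨WithLp.toLp 2 fun j => (K j : ℝ),
    (b.mem_span_iff_repr_mem ℤ _).mpr fun j => ⟨K j, by simp [b]⟩⟩
  have he : Function.Injective e := fun K K' h => funext fun j => by
    simpa [e] using congrArg (fun x : Λ => (x : EuclideanSpace ℝ (Fin 3)) j) h
  have hnorm : ∀ K, ‖e K‖ ^ 2 = waveSq K := fun K => by
    simp [e, EuclideanSpace.norm_sq_eq, waveSq]
  refine ((ZLattice.summable_norm_pow_inv Λ 4 hrank).comp_injective he).congr fun K => ?_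
  simp only [Function.comp_apply, ← hnorm, ← pow_mul, inv_pow]

/-- `∑_{K ≠ 0} |K|⁻⁴`; the term `K = 0` contributes nothing because `0⁻¹ = 0`. -/
def waveZeta : ℝ := ∑' K : Wave, (waveSq K ^ 2)⁻¹

/-- The dimensionless squared norm `∑_K |K|^{2s} |û_K|²` of `V_s`. -/
def waveSum (s : ℕ) (u : Field) : ℝ := ∑' K : Wave, waveSq K ^ s * ‖u K‖ ^ 2

lemma waveSum_nonneg (s : ℕ) (u : Field) : 0 ≤ waveSum s u :=
  tsum_nonneg fun K => mul_nonneg (pow_nonneg (waveSq_nonneg K) _) (sq_nonneg _)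

lemma normSq_eq (L : ℝ) (s : ℕ) (u : Field) :
    normSq L s u = L ^ 3 * (lam1 L ^ s * waveSum s u) := by
  simp only [normSq, waveSum, eig, mul_pow, mul_assoc, tsum_mul_left]

lemma normSq_nonneg {L : ℝ} (hL : 0 < L) (s : ℕ) (u : Field) : 0 ≤ normSq L s u := by
  rw [normSq_eq]
  have := lam1_pos hL
  have := waveSum_nonneg s u
  positivity

namespace MemV

variable {s : ℕ} {u : Field}

lemma norm_sq_le (h : MemV s u) (K : Wave) : ‖u K‖ ^ 2 ≤ waveSq K * ‖u K‖ ^ 2 := by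
  rcases eq_or_ne K 0 with rfl | hK
  · simp [h.mean_zero]
  · exact le_mul_of_one_le_left (sq_nonneg _) (one_le_waveSq hK)

lemma mono {r : ℕ} (h : MemV s u) (hrs : r ≤ s) : MemV r u where
  mean_zero := h.mean_zero
  real := h.real
  div_free := h.div_free
  summable := by
    refine Summable.of_nonneg_of_le
      (fun K => mul_nonneg (pow_nonneg (waveSq_nonneg K) _) (sq_nonneg _)) (fun K => ?_) h.summable
    rcases eq_or_ne K 0 with rfl | hK
    · simp [h.mean_zero]
    · gcongr
      exact one_le_waveSq hK

lemma hasSum_normSq (h : MemV s u) (L : ℝ) :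
    HasSum (fun K => L ^ 3 * (eig L K ^ s * ‖u K‖ ^ 2)) (normSq L s u) := by
  refine Summable.hasSum (f := fun K => eig L K ^ s * ‖u K‖ ^ 2) ?_ |>.mul_left _
  simpa only [eig, mul_pow, mul_assoc] using h.summable.mul_left (lam1 L ^ s)

end MemV

/-! ### The energy -/

/-- The Fourier multiplier `1 + a² (2π|K|/L)²` of `I + a² A`. -/
def helmSymbol (L a : ℝ) (K : Wave) : ℝ := 1 + a ^ 2 * eig L K

lemma one_le_helmSymbol {L : ℝ} (hL : 0 < L) (a : ℝ) (K : Wave) : 1 ≤ helmSymbol L a K :=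
  le_add_of_nonneg_right (mul_nonneg (sq_nonneg a) (eig_nonneg hL K))

lemma helmholtz_apply (L a : ℝ) (u : Field) (K : Wave) :
    helmholtz L a u K = helmSymbol L a K • u K := by
  change u K + ((a ^ 2 : ℝ) : ℂ) • (eig L K : ℂ) • u K = _
  rw [Complex.coe_smul, Complex.coe_smul, smul_smul, helmSymbol, add_smul, one_smul]

/-- The energy `‖u‖² + a² ‖∇u‖²`, the square of the norm adapted to the length scale `a`. -/
def energy (L a : ℝ) (u : Field) : ℝ := normSq L 0 u + a ^ 2 * normSq L 1 u

lemma MemV.hasSum_energy {u : Field} (h : MemV 1 u) (L a : ℝ) :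
    HasSum (fun K => L ^ 3 * (helmSymbol L a K * ‖u K‖ ^ 2)) (energy L a u) := by
  refine (((h.mono zero_le_one).hasSum_normSq L).add
    ((h.hasSum_normSq L).mul_left (a ^ 2))).congr_fun fun K => ?_
  rw [helmSymbol]
  ring

section Energy

variable {L : ℝ} (hL : 0 < L)
include hL

lemma energy_nonneg (a : ℝ) (u : Field) : 0 ≤ energy L a u :=
  add_nonneg (normSq_nonneg hL 0 u) (mul_nonneg (sq_nonneg a) (normSq_nonneg hL 1 u))

lemma energy_mono {a b : ℝ} (ha : 0 ≤ a) (hab : a ≤ b) (u : Field) :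
    energy L a u ≤ energy L b u := by
  have := normSq_nonneg hL 1 u
  unfold energy
  gcongr

lemma energy_le_mul_energy {a : ℝ} (ha : a ≠ 0) (b : ℝ) (u : Field) :
    energy L b u ≤ (1 + b ^ 2 / a ^ 2) * energy L a u := by
  have h0 := normSq_nonneg hL 0 u
  have h1 := normSq_nonneg hL 1 u
  have hexpand : (1 + b ^ 2 / a ^ 2) * energy L a u =
      energy L b u + (b ^ 2 / a ^ 2 * normSq L 0 u + a ^ 2 * normSq L 1 u) := by
    unfold energy
    field_simp
    ring
  rw [hexpand]
  exact le_add_of_nonneg_right (by positivity)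

end Energy

/-! ### The nonlinear term does no work -/

namespace MemV

variable {s : ℕ} {u : Field}

lemma norm_le (h : MemV s u) (K : Wave) :
    ‖u K‖ ≤ ((waveSq K ^ 2)⁻¹ + waveSq K ^ 2 * ‖u K‖ ^ 2) / 2 := by
  rcases eq_or_ne K 0 with rfl | hK
  · simp [h.mean_zero, waveSq]
  have hpos : 0 < waveSq K := zero_lt_one.trans_le (one_le_waveSq hK)
  have hyoung := two_mul_le_add_sq (waveSq K)⁻¹ (waveSq K * ‖u K‖)
  rw [mul_assoc, inv_mul_cancel_left₀ hpos.ne', inv_pow, mul_pow] at hyoung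
  linarith

lemma summable_norm (h : MemV 2 u) : Summable fun K => ‖u K‖ :=
  Summable.of_nonneg_of_le (fun _ => norm_nonneg _) h.norm_le
    ((summable_inv_waveSq_sq.add h.summable).div_const 2)

lemma tsum_norm_le (h : MemV 2 u) : ∑' K, ‖u K‖ ≤ (waveZeta + waveSum 2 u) / 2 := by
  rw [waveZeta, waveSum, ← summable_inv_waveSq_sq.tsum_add h.summable, ← tsum_div_const]
  exact h.summable_norm.tsum_le_tsum h.norm_le
    ((summable_inv_waveSq_sq.add h.summable).div_const 2)

lemma inner_neg (h : MemV s u) (K J : Wave) :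
    inner ℂ (u (-K)) (u J) = inner ℂ (u (-J)) (u K) := by
  simp only [PiLp.inner_apply, RCLike.inner_apply]
  refine Finset.sum_congr rfl fun j _ => ?_
  rw [h.real K j, h.real J j, mul_comm]
  rfl

end MemV

/-- The contribution of the triad of wave numbers `(K, J, K - J)` to `⟨u, (u·∇)u⟩`. -/
def triad (L : ℝ) (u : Field) (p : Wave × Wave) : ℂ :=
  2 * Real.pi * Complex.I / L * dotWave (u p.2) (p.1 - p.2) * inner ℂ (u p.1) (u (p.1 - p.2))

/-- The exchange `(K, J) ↦ (J - K, J)` of the two wave numbers `K` and `-(K - J)` that a triad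
pairs with each other. -/
def triadFlip : Wave × Wave ≃ Wave × Wave where
  toFun p := (p.2 - p.1, p.2)
  invFun p := (p.2 - p.1, p.2)
  left_inv p := by simp
  right_inv p := by simp

/-- The change of variables `(K, J) ↦ (K - J, J)` in sums over triads. -/
def triadShift : Wave × Wave ≃ Wave × Wave where
  toFun p := (p.1 - p.2, p.2)
  invFun p := (p.1 + p.2, p.2)
  left_inv p := by simp
  right_inv p := by simp

/-- The summable function `|I|² |û_I|² |û_J|` of `(I, J)` that dominates the triads. -/
def triadMajorant (u : Field) (p : Wave × Wave) : ℝ := waveSq p.1 * ‖u p.1‖ ^ 2 * ‖u p.2‖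

namespace MemV

variable {s : ℕ} {u : Field}

lemma triad_flip (h : MemV s u) (L : ℝ) (p : Wave × Wave) :
    triad L u (triadFlip p) = -triad L u p := by
  obtain ⟨K, J⟩ := p
  have hK : J - K - J = -K := by abel
  have hKJ : J - K = -(K - J) := by abel
  have hdot : dotWave (u J) (-K) = -dotWave (u J) (K - J) := by
    rw [dotWave_neg, dotWave_sub, h.div_free, sub_zero]
  simp only [triad, triadFlip, Equiv.coe_fn_mk, hK]
  rw [hKJ, h.inner_neg (K - J) (-K), neg_neg, hdot]
  ring

lemma norm_triad_le (h : MemV s u) (L : ℝ) (p : Wave × Wave) :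
    ‖triad L u p‖ ≤ ‖2 * Real.pi * Complex.I / (L : ℂ)‖ *
      ((triadMajorant u (triadShift p) + triadMajorant u p) / 2) := by
  obtain ⟨K, J⟩ := p
  simp only [triad, triadShift, triadMajorant, Equiv.coe_fn_mk]
  rw [mul_assoc, norm_mul]
  gcongr
  set q := √(waveSq (K - J))
  have hq : q ^ 2 = waveSq (K - J) := Real.sq_sqrt (waveSq_nonneg _)
  calc ‖dotWave (u J) (K - J) * inner ℂ (u K) (u (K - J))‖
      ≤ (‖u J‖ * q) * (‖u K‖ * ‖u (K - J)‖) := by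
        rw [norm_mul]
        gcongr
        exacts [norm_dotWave_le _ _, norm_inner_le_norm _ _]
    _ ≤ ‖u J‖ * (((q * ‖u (K - J)‖) ^ 2 + ‖u K‖ ^ 2) / 2) := by
        rw [mul_assoc]
        gcongr
        linarith [two_mul_le_add_sq (q * ‖u (K - J)‖) ‖u K‖]
    _ ≤ ‖u J‖ * ((waveSq (K - J) * ‖u (K - J)‖ ^ 2 + waveSq K * ‖u K‖ ^ 2) / 2) := by
        rw [mul_pow, hq]
        gcongr
        exact h.norm_sq_le K
    _ = _ := by ring

lemma hasSum_triadMajorant (h : MemV 2 u) :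
    HasSum (triadMajorant u) (waveSum 1 u * ∑' K, ‖u K‖) := by
  have hgrad := (h.mono one_le_two).summable
  have hsummable := hgrad.mul_of_nonneg h.summable_norm
    (fun K => mul_nonneg (pow_nonneg (waveSq_nonneg K) _) (sq_nonneg _)) fun _ => norm_nonneg _
  exact (hgrad.hasSum.mul h.summable_norm.hasSum hsummable).congr_fun fun p => by
    rw [triadMajorant, pow_one]

lemma hasSum_triadMajorant_avg (h : MemV 2 u) :
    HasSum (fun p => (triadMajorant u (triadShift p) + triadMajorant u p) / 2)
      (waveSum 1 u * ∑' K, ‖u K‖) := by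
  simpa only [add_self_div_two, Function.comp_apply] using
    ((triadShift.hasSum_iff.mpr h.hasSum_triadMajorant).add h.hasSum_triadMajorant).div_const 2

lemma summable_norm_triad (h : MemV 2 u) (L : ℝ) : Summable fun p => ‖triad L u p‖ :=
  Summable.of_nonneg_of_le (fun _ => norm_nonneg _) (h.norm_triad_le L)
    (h.hasSum_triadMajorant_avg.summable.mul_left _)

lemma tsum_norm_triad_le (h : MemV 2 u) (L : ℝ) :
    ∑' p, ‖triad L u p‖ ≤
      ‖2 * Real.pi * Complex.I / (L : ℂ)‖ * (waveSum 1 u * ((waveZeta + waveSum 2 u) / 2)) := by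
  have hsum := h.hasSum_triadMajorant_avg.mul_left ‖2 * Real.pi * Complex.I / (L : ℂ)‖
  calc ∑' p, ‖triad L u p‖
      ≤ ‖2 * Real.pi * Complex.I / (L : ℂ)‖ * (waveSum 1 u * ∑' K, ‖u K‖) :=
        hasSum_le (h.norm_triad_le L) (h.summable_norm_triad L).hasSum hsum
    _ ≤ _ := by
        gcongr
        exacts [waveSum_nonneg _ _, h.tsum_norm_le]

lemma tsum_triad (h : MemV s u) (L : ℝ) : ∑' p, triad L u p = 0 := by
  have hflip : ∑' p, triad L u p = -∑' p, triad L u p := by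
    rw [← tsum_neg, ← triadFlip.tsum_eq (triad L u)]
    exact tsum_congr (h.triad_flip L)
  exact self_eq_neg.mp hflip

lemma inner_leray (h : MemV s u) (v : Field) (K : Wave) :
    inner ℂ (u K) (leray v K) = inner ℂ (u K) (v K) := by
  rcases eq_or_ne K 0 with rfl | hK
  · simp [h.mean_zero]
  have horth : inner ℂ (u K) (WithLp.toLp 2 fun j => (K j : ℂ)) = 0 := by
    have hconj : inner ℂ (u K) (WithLp.toLp 2 fun j => (K j : ℂ)) = star (dotWave (u K) K) := by
      simp [PiLp.inner_apply, dotWave, mul_comm]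
    rw [hconj, h.div_free, star_zero]
  simp only [leray, hK, if_false, inner_sub_right, inner_smul_right, horth, mul_zero, sub_zero]

lemma summable_advect (h : MemV 1 u) (L : ℝ) (K : Wave) : Summable fun J : Wave =>
    (2 * Real.pi * Complex.I / L * dotWave (u J) (K - J)) • u (K - J) := by
  have hgrad : Summable fun J => waveSq J * ‖u J‖ ^ 2 := by simpa only [pow_one] using h.summable
  have hgrad' : Summable fun J => waveSq (K - J) * ‖u (K - J)‖ ^ 2 :=
    (Equiv.subLeft K).summable_iff.mpr hgrad
  refine Summable.of_norm_bounded
    (((hgrad.add hgrad').div_const 2).mul_left ‖2 * Real.pi * Complex.I / (L : ℂ)‖) fun J => ?_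
  rw [norm_smul, norm_mul, mul_assoc]
  gcongr
  set q := √(waveSq (K - J))
  have hq : q ^ 2 = waveSq (K - J) := Real.sq_sqrt (waveSq_nonneg _)
  calc ‖dotWave (u J) (K - J)‖ * ‖u (K - J)‖
      ≤ ‖u J‖ * q * ‖u (K - J)‖ := by
        gcongr
        exact norm_dotWave_le _ _
    _ ≤ (‖u J‖ ^ 2 + (q * ‖u (K - J)‖) ^ 2) / 2 := by
        linarith [two_mul_le_add_sq ‖u J‖ (q * ‖u (K - J)‖)]
    _ ≤ _ := by
        rw [mul_pow, hq]
        gcongr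
        exact h.norm_sq_le J

lemma inner_bilin (h : MemV 1 u) (L : ℝ) (K : Wave) :
    inner ℂ (u K) (bilin L u u K) = ∑' J, triad L u (K, J) := by
  rw [bilin, h.inner_leray, advect, ← innerSL_apply_apply,
    (innerSL ℂ (u K)).map_tsum (h.summable_advect L K)]
  simp only [innerSL_apply_apply, inner_smul_right, triad]

end MemV

lemma inner_real_eq_re_inner_complex (x y : EuclideanSpace ℂ (Fin 3)) :
    inner ℝ x y = (inner ℂ x y).re := by
  simp [PiLp.inner_apply, Complex.inner]

/-- The rate at which the nonlinear term takes energy out of the mode `K`. -/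
def transfer (L : ℝ) (u : Field) (K : Wave) : ℝ := inner ℝ (u K) (bilin L u u K)

namespace MemV

variable {u : Field}

lemma transfer_eq (h : MemV 1 u) (L : ℝ) (K : Wave) :
    transfer L u K = (∑' J, triad L u (K, J)).re := by
  rw [transfer, inner_real_eq_re_inner_complex, h.inner_bilin]

lemma hasSum_transfer (h : MemV 2 u) (L : ℝ) : HasSum (transfer L u) 0 := by
  have htriad := (h.summable_norm_triad L).of_norm
  have hsum := htriad.hasSum.prod_fiberwise fun K => (htriad.prod_factor K).hasSum
  rw [h.tsum_triad] at hsum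
  exact (Complex.hasSum_re hsum).congr_fun fun K => (h.mono one_le_two).transfer_eq L K

lemma abs_sum_transfer_le (h : MemV 2 u) (L : ℝ) (S : Finset Wave) :
    |∑ K ∈ S, transfer L u K| ≤
      ‖2 * Real.pi * Complex.I / (L : ℂ)‖ * (waveSum 1 u * ((waveZeta + waveSum 2 u) / 2)) := by
  have hs := h.summable_norm_triad L
  calc |∑ K ∈ S, transfer L u K|
      ≤ ∑ K ∈ S, ∑' J, ‖triad L u (K, J)‖ :=
        (Finset.abs_sum_le_sum_abs _ _).trans <| Finset.sum_le_sum fun K _ => by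
          rw [(h.mono one_le_two).transfer_eq]
          exact (Complex.abs_re_le_norm _).trans (norm_tsum_le_tsum_norm (hs.prod_factor K))
    _ ≤ ∑' p, ‖triad L u p‖ := by
        rw [hs.tsum_prod]
        exact hs.prod.sum_le_tsum S fun K _ => tsum_nonneg fun _ => norm_nonneg _
    _ ≤ _ := h.tsum_norm_triad_le L

end MemV

/-! ### The energy inequality -/

lemma waveSum_le_two_mul_add {s : ℕ} {u v : Field} (hu : MemV s u) (hv : MemV s v) :
    waveSum s v ≤ 2 * (waveSum s (v - u) + waveSum s u) := by
  have hadd (K : Wave) (x y : EuclideanSpace ℂ (Fin 3)) : waveSq K ^ s * ‖x + y‖ ^ 2 ≤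
      2 * (waveSq K ^ s * ‖x‖ ^ 2 + waveSq K ^ s * ‖y‖ ^ 2) := by
    rw [← mul_add, mul_left_comm]
    have := pow_nonneg (waveSq_nonneg K) s
    gcongr
    exact (pow_le_pow_left₀ (norm_nonneg _) (norm_add_le x y) 2).trans add_sq_le
  have hsub : Summable fun K => waveSq K ^ s * ‖(v - u) K‖ ^ 2 :=
    Summable.of_nonneg_of_le
      (fun K => mul_nonneg (pow_nonneg (waveSq_nonneg K) _) (sq_nonneg _))
      (fun K => by simpa only [Pi.sub_apply, sub_eq_add_neg, norm_neg] using hadd K (v K) (-u K))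
      ((hv.summable.add hu.summable).mul_left 2)
  refine hasSum_le (fun K => ?_) hv.summable.hasSum
    ((hsub.hasSum.add hu.summable.hasSum).mul_left 2)
  simpa only [Pi.sub_apply, sub_add_cancel] using hadd K (v K - u K) (u K)

/-- The power `2 ⟨F, w⟩ + γ (‖w‖² + a²‖∇w‖²) - 2ν (‖∇w‖² + a²‖Aw‖²)` that the mode `K` gains from
the forcing and the weight `e^{γt}`, less what it dissipates. -/
def netPower (L ν a γ : ℝ) (F w : Field) (K : Wave) : ℝ :=
  2 * inner ℝ (w K) (F K) + (γ - 2 * ν * eig L K) * (helmSymbol L a K * ‖w K‖ ^ 2)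

lemma helmholtz_power_eq (L ν a γ : ℝ) (F w : Field) (K : Wave) :
    γ * ‖helmholtz L a w K‖ ^ 2 + 2 * inner ℝ (helmholtz L a w K)
        (F K - (ν : ℂ) • stokes L (helmholtz L a w) K - bilin L w w K) =
      helmSymbol L a K * (netPower L ν a γ F w K - 2 * transfer L w K) := by
  have hstokes : (ν : ℂ) • stokes L (helmholtz L a w) K =
      (ν * eig L K * helmSymbol L a K) • w K := by
    rw [stokes, helmholtz_apply, Complex.coe_smul, Complex.coe_smul, smul_smul, smul_smul]
  rw [hstokes, helmholtz_apply, norm_smul, mul_pow, Real.norm_eq_abs, sq_abs,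
    real_inner_smul_left, inner_sub_right, inner_sub_right, real_inner_smul_right,
    real_inner_self_eq_norm_sq, netPower, transfer]
  ring

namespace IsSolution

variable {L ν a : ℝ} {F w : ℝ → Field} {I : Set ℝ}

lemma mono {J : Set ℝ} (h : IsSolution L ν a F I w) (hJ : J ⊆ I) : IsSolution L ν a F J w where
  mem_V t ht := h.mem_V t (hJ ht)
  continuous_V t ht := (h.continuous_V t (hJ ht)).mono_left (nhdsWithin_mono _ hJ)
  mem_DA := ae_restrict_of_ae_restrict_of_subset hJ h.mem_DA
  sq_integrable_DA t₀ h₀ t₁ h₁ := h.sq_integrable_DA t₀ (hJ h₀) t₁ (hJ h₁)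
  integrable K t₀ h₀ t₁ h₁ := h.integrable K t₀ (hJ h₀) t₁ (hJ h₁)
  equation K t₀ h₀ t₁ h₁ := h.equation K t₀ (hJ h₀) t₁ (hJ h₁)

lemma bddAbove_waveSum (h : IsSolution L ν a F I w) (hL : 0 < L) (hI : IsCompact I) :
    BddAbove ((fun t => waveSum 1 (w t)) '' I) := by
  refine hI.induction_on (p := fun J => BddAbove ((fun t => waveSum 1 (w t)) '' J)) (by simp)
    (fun J J' hJ => BddAbove.mono (image_mono hJ)) (fun J J' hJ hJ' => ?_) fun x hx => ?_
  · rw [image_union]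
    exact hJ.union hJ'
  have hpos : 0 < L ^ 3 * lam1 L := mul_pos (pow_pos hL 3) (lam1_pos hL)
  refine ⟨_, inter_mem ((h.continuous_V x hx).eventually (gt_mem_nhds hpos))
    self_mem_nhdsWithin, 2 * (1 + waveSum 1 (w x)), ?_⟩
  rintro _ ⟨t, ⟨ht, htI⟩, rfl⟩
  have hclose : waveSum 1 (w t - w x) < 1 := by
    rw [mem_ofPred_eq, normSq_eq, pow_one, ← mul_assoc] at ht
    exact (mul_lt_iff_lt_one_right hpos).mp ht
  linarith [waveSum_le_two_mul_add (h.mem_V x hx) (h.mem_V t htI)]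

variable {T₀ T₁ : ℝ}

lemma exists_integrable_abs_sum_transfer_le (h : IsSolution L ν a F (Icc T₀ T₁) w) (hL : 0 < L)
    (hT : T₀ ≤ T₁) : ∃ b : ℝ → ℝ, IntegrableOn b (Icc T₀ T₁) ∧
      ∀ᵐ s ∂volume.restrict (Icc T₀ T₁), ∀ S : Finset Wave,
        |∑ K ∈ S, transfer L (w s) K| ≤ b s := by
  obtain ⟨M, hM⟩ := h.bddAbove_waveSum hL isCompact_Icc
  have hzeta : 0 ≤ waveZeta := tsum_nonneg fun K => by positivity
  have hint : IntegrableOn (fun s => waveSum 2 (w s)) (Icc T₀ T₁) := by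
    have hne : L ^ 3 * lam1 L ^ 2 ≠ 0 := by have := lam1_pos hL; positivity
    refine ((h.sq_integrable_DA T₀ (left_mem_Icc.mpr hT) T₁ (right_mem_Icc.mpr hT)).const_mul
      (L ^ 3 * lam1 L ^ 2)⁻¹).congr (ae_of_all _ fun s => ?_)
    simp only [normSq_eq, ← mul_assoc (L ^ 3), inv_mul_cancel_left₀ hne]
  refine ⟨fun s => ‖2 * Real.pi * Complex.I / (L : ℂ)‖ * (M * ((waveZeta + waveSum 2 (w s)) / 2)),
    ((((integrable_const _).add hint).div_const 2).const_mul M).const_mul _, ?_⟩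
  filter_upwards [h.mem_DA, ae_restrict_mem measurableSet_Icc] with s hs hsI S
  refine (hs.abs_sum_transfer_le L S).trans ?_
  have := waveSum_nonneg 2 (w s)
  gcongr
  exact hM (mem_image_of_mem _ hsI)

lemma integral_exp_mul_netPower_sub_transfer (h : IsSolution L ν a F (Icc T₀ T₁) w) (hL : 0 < L)
    (hT : T₀ ≤ T₁) (γ : ℝ) (K : Wave) :
    IntegrableOn (fun s => Real.exp (γ * s) *
      (netPower L ν a γ (F s) (w s) K - 2 * transfer L (w s) K)) (Ioc T₀ T₁) ∧
    ∫ s in Ioc T₀ T₁, Real.exp (γ * s) *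
      (netPower L ν a γ (F s) (w s) K - 2 * transfer L (w s) K) =
      Real.exp (γ * T₁) * (helmSymbol L a K * ‖w T₁ K‖ ^ 2) -
        Real.exp (γ * T₀) * (helmSymbol L a K * ‖w T₀ K‖ ^ 2) := by
  have hm : helmSymbol L a K ≠ 0 := (zero_lt_one.trans_le (one_le_helmSymbol hL a K)).ne'
  have hT₀ : T₀ ∈ Icc T₀ T₁ := left_mem_Icc.mpr hT
  obtain ⟨hint, heq⟩ := integral_exp_mul_deriv_norm_sq (y := fun s => helmholtz L a (w s) K) γ
    (h.integrable K T₀ hT₀ T₁ (right_mem_Icc.mpr hT)) fun t ht =>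
      h.equation K T₀ hT₀ t (uIcc_of_le hT ▸ ht)
  simp only [helmholtz_power_eq, mul_left_comm _ (helmSymbol L a K)] at hint heq
  rw [intervalIntegrable_iff_integrableOn_Ioc_of_le hT] at hint
  refine ⟨(integrable_const_mul_iff hm.isUnit _).mp hint, mul_left_cancel₀ hm ?_⟩
  rw [intervalIntegral.integral_const_mul, intervalIntegral.integral_of_le hT] at heq
  rw [heq]
  simp only [helmholtz_apply, norm_smul, mul_pow, Real.norm_eq_abs, sq_abs]
  ring

/-- The nonlinear term drops out of the energy balance of all modes together; the truncation to
finitely many modes leaves an error that tends to `0` and is dominated by an integrable function. -/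
lemma exp_mul_energy_sub_le (h : IsSolution L ν a F (Icc T₀ T₁) w) (hL : 0 < L) (hT : T₀ ≤ T₁)
    {γ C : ℝ} (hpow : ∀ᵐ s ∂volume.restrict (Icc T₀ T₁), ∀ S : Finset Wave,
      ∑ K ∈ S, L ^ 3 * netPower L ν a γ (F s) (w s) K ≤ C) :
    Real.exp (γ * T₁) * energy L a (w T₁) - Real.exp (γ * T₀) * energy L a (w T₀) ≤
      ∫ s in Ioc T₀ T₁, Real.exp (γ * s) * C := by
  obtain ⟨b, hb, hle⟩ := h.exists_integrable_abs_sum_transfer_le hL hT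
  have hsub : Ioc T₀ T₁ ⊆ Icc T₀ T₁ := Ioc_subset_Icc_self
  have hexp : Continuous fun s : ℝ => Real.exp (γ * s) := by fun_prop
  have hmode := h.integral_exp_mul_netPower_sub_transfer hL hT γ
  let r : Finset Wave → ℝ → ℝ := fun S s =>
    -(2 * L ^ 3) * (Real.exp (γ * s) * ∑ K ∈ S, transfer L (w s) K)
  refine le_integral_of_tendsto_of_le_add (l := atTop) (r := r)
    (b := fun s => |-(2 * L ^ 3)| * (Real.exp (γ * s) * b s))
    (G := fun S s => ∑ K ∈ S, L ^ 3 * (Real.exp (γ * s) *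
      (netPower L ν a γ (F s) (w s) K - 2 * transfer L (w s) K)))
    (fun S => integrable_finsetSum S fun K _ => (hmode K).1.const_mul _)
    ((hexp.mul continuous_const).integrableOn_Ioc)
    (((hb.continuousOn_mul hexp.continuousOn isCompact_Icc).mono_set hsub).const_mul _) ?_ ?_ ?_ ?_
  · filter_upwards [ae_restrict_of_ae_restrict_of_subset hsub hpow] with s hs S
    calc ∑ K ∈ S, L ^ 3 * (Real.exp (γ * s) *
          (netPower L ν a γ (F s) (w s) K - 2 * transfer L (w s) K))
        = Real.exp (γ * s) * ∑ K ∈ S, L ^ 3 * netPower L ν a γ (F s) (w s) K + r S s := by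
          simp only [r, Finset.mul_sum, ← Finset.sum_add_distrib]
          exact Finset.sum_congr rfl fun K _ => by ring
      _ ≤ Real.exp (γ * s) * C + r S s := by
          gcongr
          exact hs S
  · filter_upwards [ae_restrict_of_ae_restrict_of_subset hsub hle] with s hs S
    simp only [r, abs_mul, Real.abs_exp]
    gcongr
    exact hs S
  · filter_upwards [ae_restrict_of_ae_restrict_of_subset hsub h.mem_DA] with s hs
    have := ((hs.hasSum_transfer L).const_mul (Real.exp (γ * s))).const_mul (-(2 * L ^ 3))
    rwa [mul_zero, mul_zero] at this
  · simp only [integral_finsetSum _ fun K _ => (hmode K).1.const_mul (L ^ 3), integral_const_mul,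
      (hmode _).2]
    have hE (T : ℝ) (hT : T ∈ Icc T₀ T₁) :=
      ((h.mem_V T hT).hasSum_energy L a).mul_left (Real.exp (γ * T))
    refine ((hE T₁ (right_mem_Icc.mpr hT)).sub (hE T₀ (left_mem_Icc.mpr hT))).congr_fun fun K => ?_
    ring

theorem energy_le (h : IsSolution L ν a F (Icc T₀ T₁) w) (hL : 0 < L) (hT : T₀ ≤ T₁)
    {γ C : ℝ} (hγ : 0 < γ) (hC : 0 ≤ C)
    (hpow : ∀ᵐ s ∂volume.restrict (Icc T₀ T₁), ∀ S : Finset Wave,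
      ∑ K ∈ S, L ^ 3 * netPower L ν a γ (F s) (w s) K ≤ C) :
    energy L a (w T₁) ≤ Real.exp (-(γ * (T₁ - T₀))) * energy L a (w T₀) + C / γ := by
  have hint : ∫ s in Ioc T₀ T₁, Real.exp (γ * s) * C ≤ Real.exp (γ * T₁) * (C / γ) := by
    rw [← intervalIntegral.integral_of_le hT, intervalIntegral.integral_mul_const,
      intervalIntegral.integral_comp_mul_left _ hγ.ne', integral_exp, smul_eq_mul,
      ← div_eq_inv_mul, div_mul_eq_mul_div, mul_div_assoc]
    gcongr
    exact sub_le_self _ (Real.exp_pos _).le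
  have hbalance := h.exp_mul_energy_sub_le hL hT hpow
  refine le_of_mul_le_mul_left ?_ (Real.exp_pos (γ * T₁))
  calc Real.exp (γ * T₁) * energy L a (w T₁)
      ≤ Real.exp (γ * T₀) * energy L a (w T₀) + Real.exp (γ * T₁) * (C / γ) := by linarith
    _ = _ := by
      rw [mul_add, ← mul_assoc, ← Real.exp_add]
      ring_nf

end IsSolution

/-! ### Forcing bounds -/

lemma two_mul_inner_le {E : Type*} [NormedAddCommGroup E] [InnerProductSpace ℝ E] (x y : E)
    {c : ℝ} (hc : 0 < c) : 2 * inner ℝ x y ≤ c * ‖x‖ ^ 2 + ‖y‖ ^ 2 / c := by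
  have hsq : c * ‖x‖ ^ 2 + ‖y‖ ^ 2 / c - 2 * (‖x‖ * ‖y‖) = (c * ‖x‖ - ‖y‖) ^ 2 / c := by
    field_simp
    ring
  have hnonneg : 0 ≤ (c * ‖x‖ - ‖y‖) ^ 2 / c := by positivity
  linarith [real_inner_le_norm x y]

lemma MemLinfH.ae_normSq_le {L : ℝ} {f : ℝ → Field} (hf : MemLinfH L f) :
    ∀ᵐ s ∂volume.restrict (Ici (0 : ℝ)), normSq L 0 (f s) ≤ supNorm L f ^ 2 := by
  filter_upwards [ae_le_eLpNormEssSup (f := fun t => √(normSq L 0 (f t)))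
    (μ := volume.restrict (Ici 0))] with s hs
  rw [← eLpNorm_exponent_top] at hs
  have hsqrt := ENNReal.toReal_mono hf.bounded.2.ne hs
  rw [toReal_enorm, Real.norm_of_nonneg (Real.sqrt_nonneg _)] at hsqrt
  exact (Real.sqrt_le_left (by unfold supNorm; positivity)).mp hsqrt

lemma MemV.sum_norm_sq_le {f : Field} (hf : MemV 0 f) {L : ℝ} (hL : 0 < L) (S : Finset Wave) :
    ∑ K ∈ S, L ^ 3 * ‖f K‖ ^ 2 ≤ normSq L 0 f := by
  have := hf.hasSum_normSq L
  simp only [pow_zero, one_mul] at this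
  exact sum_le_hasSum S (fun K _ => by positivity) this

lemma MemV.sum_energy_le {u : Field} (hu : MemV 1 u) {L : ℝ} (hL : 0 < L) (a : ℝ)
    (S : Finset Wave) : ∑ K ∈ S, L ^ 3 * (helmSymbol L a K * ‖u K‖ ^ 2) ≤ energy L a u :=
  sum_le_hasSum S (fun K _ => by have := one_le_helmSymbol hL a K; positivity)
    (hu.hasSum_energy L a)

lemma netPower_of_eq_zero {w : Field} {K : Wave} (hw : w K = 0) (L ν a γ : ℝ) (F : Field) :
    netPower L ν a γ F w K = 0 := by
  simp [netPower, hw]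

variable {L ν : ℝ}

lemma netPower_le (hL : 0 < L) {γ : ℝ} (hγ : 0 < γ) {K : Wave} (hK : γ ≤ ν * eig L K) (a : ℝ)
    (F w : Field) : netPower L ν a γ F w K ≤ ‖F K‖ ^ 2 / γ := by
  have hyoung := two_mul_inner_le (w K) (F K) hγ
  have hdiss : γ * ‖w K‖ ^ 2 ≤ (2 * ν * eig L K - γ) * (helmSymbol L a K * ‖w K‖ ^ 2) := by
    gcongr
    · linarith
    · linarith
    · exact le_mul_of_one_le_left (sq_nonneg _) (one_le_helmSymbol hL a K)
  unfold netPower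
  linarith

theorem IsBardinaSolution.energy_le {α : ℝ} {f u : ℝ → Field} (hu : IsBardinaSolution L ν α f u)
    (hL : 0 < L) (hν : 0 < ν) (hf : MemLinfH L f) {s : ℝ} (hs : 0 ≤ s) :
    energy L α (u s) ≤ Real.exp (-(ν * lam1 L * s)) * energy L α (u 0) +
      1 / (lam1 L ^ 2 * ν ^ 2) * supNorm L f ^ 2 := by
  have hsub : Icc 0 s ⊆ Ici 0 := Icc_subset_Ici_self
  have hlam := lam1_pos hL
  have hγ : 0 < ν * lam1 L := mul_pos hν hlam
  have henergy := (IsSolution.mono hu hsub).energy_le hL hs hγ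
    (C := supNorm L f ^ 2 / (ν * lam1 L)) (by positivity) ?_
  · convert henergy using 2
    · rw [sub_zero]
    · field_simp
  filter_upwards [ae_restrict_of_ae_restrict_of_subset hsub hf.mem,
    ae_restrict_of_ae_restrict_of_subset hsub hf.ae_normSq_le, ae_restrict_mem measurableSet_Icc]
    with r hfr hfle hr S
  calc ∑ K ∈ S, L ^ 3 * netPower L ν α (ν * lam1 L) (f r) (u r) K
      ≤ ∑ K ∈ S, L ^ 3 * (‖f r K‖ ^ 2 / (ν * lam1 L)) := by
        gcongr with K
        rcases eq_or_ne K 0 with rfl | hK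
        · rw [netPower_of_eq_zero (hu.mem_V r (hsub hr)).mean_zero]
          positivity
        · exact netPower_le hL hγ (by gcongr; exact lam1_le_eig hL hK) _ _ _
    _ = (∑ K ∈ S, L ^ 3 * ‖f r K‖ ^ 2) / (ν * lam1 L) := by
        simp only [Finset.sum_div, mul_div_assoc]
    _ ≤ supNorm L f ^ 2 / (ν * lam1 L) := by
        gcongr
        exact (hfr.sum_norm_sq_le hL S).trans hfle

theorem IsBardinaSolution.energy_le_M1sq {α α₁ MA MB : ℝ} {f u : ℝ → Field}
    (hu : IsBardinaSolution L ν α f u) (hL : 0 < L) (hν : 0 < ν) (hα : 0 ≤ α) (hαα₁ : α ≤ α₁)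
    (hf : MemLinfH L f) (hMA : √(normSq L 0 (u 0)) ≤ MA) (hMB : √(normSq L 1 (u 0)) ≤ MB)
    {r s : ℝ} (hr : 0 ≤ r) (hrs : r ≤ s) : energy L α (u s) ≤ M1sq L ν α₁ MA MB f r := by
  have hlam := lam1_pos hL
  have hinit : energy L α (u 0) ≤ MA ^ 2 + α₁ ^ 2 * MB ^ 2 := by
    refine (energy_mono hL hα hαα₁ _).trans ?_
    unfold energy
    gcongr
    exacts [(Real.sqrt_le_iff.mp hMA).2, (Real.sqrt_le_iff.mp hMB).2]
  refine (hu.energy_le hL hν hf (hr.trans hrs)).trans ?_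
  unfold M1sq
  have := energy_nonneg hL α (u 0)
  gcongr

/-- The right-hand side `f - η (I + β² A) 𝒫 (P_N w - P_N u)` of the nudged system at a fixed
time. -/
def nudgedForcing (L β η : ℝ) (N : ℕ) (f w u : Field) : Field :=
  f - (η : ℂ) • helmholtz L β (leray (lowModes N w - lowModes N u))

lemma nudgedForcing_apply_of_lt {r s : ℕ} {w u : Field} (hw : MemV r w) (hu : MemV s u) {N : ℕ}
    {K : Wave} (hK : K ≠ 0) (hKN : waveSq K < (N : ℝ) ^ 2) (L β η : ℝ) (f : Field) :
    nudgedForcing L β η N f w u K = f K - (η * helmSymbol L β K) • (w K - u K) := by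
  have hdiv : dotWave (w K - u K) K = 0 := by
    have hsub : dotWave (w K - u K) K = dotWave (w K) K - dotWave (u K) K := by
      simp [dotWave, sub_mul, Finset.sum_sub_distrib]
    rw [hsub, hw.div_free, hu.div_free, sub_zero]
  have hleray : leray (lowModes N w - lowModes N u) K = w K - u K := by
    simp [leray, lowModes, hK, hKN, hdiv]
  rw [nudgedForcing, Pi.sub_apply, Pi.smul_apply, helmholtz_apply, hleray, Complex.coe_smul,
    smul_smul]

lemma nudgedForcing_apply_of_le {N : ℕ} {K : Wave} (hKN : (N : ℝ) ^ 2 ≤ waveSq K) (L β η : ℝ)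
    (f w u : Field) : nudgedForcing L β η N f w u K = f K := by
  have hleray : leray (lowModes N w - lowModes N u) K = 0 := by
    simp [leray, lowModes, hKN.not_gt, dotWave]
  rw [nudgedForcing, Pi.sub_apply, Pi.smul_apply, helmholtz_apply, hleray, smul_zero, smul_zero,
    sub_zero]

/-- On the observed modes the nudging term absorbs the weight; on the others viscosity does, since
`η / 2 ≤ ν λ₁ N²`. -/
lemma netPower_nudgedForcing_le {r s : ℕ} {w u : Field} (hw : MemV r w) (hu : MemV s u)
    (hL : 0 < L) (hν : 0 ≤ ν) {η : ℝ} (hη : 0 < η) {N : ℕ} (hηN : η ≤ 2 * ν * lam1 L * N ^ 2)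
    (β : ℝ) (f : Field) (K : Wave) :
    netPower L ν β (η / 2) (nudgedForcing L β η N f w u) w K ≤
      ‖f K‖ ^ 2 / (η / 2) + η * (helmSymbol L β K * ‖u K‖ ^ 2) := by
  have hm := one_le_helmSymbol hL β K
  have he := eig_nonneg hL K
  have hlam := lam1_pos hL
  rcases eq_or_ne K 0 with rfl | hK
  · rw [netPower_of_eq_zero hw.mean_zero]
    positivity
  rcases lt_or_ge (waveSq K) ((N : ℝ) ^ 2) with hlow | hhigh
  · have hyoung_f := two_mul_inner_le (w K) (f K) (half_pos hη)
    have hyoung_u : η * helmSymbol L β K * (2 * inner ℝ (w K) (u K)) ≤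
        η * helmSymbol L β K * (‖w K‖ ^ 2 + ‖u K‖ ^ 2) := by
      gcongr
      simpa only [one_mul, div_one] using two_mul_inner_le (w K) (u K) one_pos
    have hweight : η / 2 * ‖w K‖ ^ 2 ≤ η / 2 * (helmSymbol L β K * ‖w K‖ ^ 2) := by
      gcongr
      exact le_mul_of_one_le_left (sq_nonneg _) hm
    have hdiss : 0 ≤ 2 * ν * eig L K * (helmSymbol L β K * ‖w K‖ ^ 2) := by positivity
    rw [netPower, nudgedForcing_apply_of_lt hw hu hK hlow, inner_sub_right, real_inner_smul_right,
      inner_sub_right, real_inner_self_eq_norm_sq]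
    linarith
  · have hvisc : η / 2 ≤ ν * eig L K := by
      have : ν * lam1 L * N ^ 2 ≤ ν * lam1 L * waveSq K := by gcongr
      rw [eig]
      linarith
    refine (netPower_le hL (half_pos hη) hvisc _ _ _).trans ?_
    rw [nudgedForcing_apply_of_le hhigh]
    exact le_add_of_nonneg_right (by positivity)

theorem IsNudgedSolution.energy_le {β η T₀ T₁ E : ℝ} {N : ℕ} {f u w : ℝ → Field}
    (hw : IsNudgedSolution L ν β η N f u (Icc T₀ T₁) w) (hL : 0 < L) (hν : 0 ≤ ν) (hη : 0 < η)
    (hηN : η ≤ 2 * ν * lam1 L * N ^ 2) (hf : MemLinfH L f) (hT₀ : 0 ≤ T₀) (hT : T₀ ≤ T₁)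
    (hu : ∀ s ∈ Icc T₀ T₁, MemV 1 (u s)) (huE : ∀ s ∈ Icc T₀ T₁, energy L β (u s) ≤ E) :
    energy L β (w T₁) ≤ Real.exp (-(η / 2 * (T₁ - T₀))) * energy L β (w T₀) +
      (4 / η ^ 2 * supNorm L f ^ 2 + 2 * E) := by
  have hsub : Icc T₀ T₁ ⊆ Ici 0 := fun s hs => hT₀.trans hs.1
  have hE : 0 ≤ E := (energy_nonneg hL β (u T₀)).trans (huE T₀ (left_mem_Icc.mpr hT))
  have henergy := IsSolution.energy_le hw hL hT (half_pos hη)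
    (C := supNorm L f ^ 2 / (η / 2) + η * E) (by positivity) ?_
  · convert henergy using 2
    field_simp
    ring
  filter_upwards [ae_restrict_of_ae_restrict_of_subset hsub hf.mem,
    ae_restrict_of_ae_restrict_of_subset hsub hf.ae_normSq_le, ae_restrict_mem measurableSet_Icc]
    with s hfs hfle hs S
  calc ∑ K ∈ S, L ^ 3 * netPower L ν β (η / 2) (nudgedForcing L β η N (f s) (w s) (u s)) (w s) K
      ≤ ∑ K ∈ S, L ^ 3 * (‖f s K‖ ^ 2 / (η / 2) + η * (helmSymbol L β K * ‖u s K‖ ^ 2)) := by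
        gcongr with K
        exact netPower_nudgedForcing_le (hw.mem_V s hs) (hu s hs) hL hν hη hηN _ _ _
    _ = (∑ K ∈ S, L ^ 3 * ‖f s K‖ ^ 2) / (η / 2) +
          η * ∑ K ∈ S, L ^ 3 * (helmSymbol L β K * ‖u s K‖ ^ 2) := by
        rw [Finset.sum_div, Finset.mul_sum, ← Finset.sum_add_distrib]
        exact Finset.sum_congr rfl fun K _ => by ring
    _ ≤ supNorm L f ^ 2 / (η / 2) + η * E := by
        gcongr
        exacts [(hfs.sum_norm_sq_le hL S).trans hfle,
          ((hu s hs).sum_energy_le hL β S).trans (huE s hs)]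

end Bardina

end

theorem proposition5p4_general
    (L ν α α₀ α₁ MA MB : ℝ) (hL : 0 < L) (hν : 0 < ν)
    (hα₀ : 0 < α₀) (hα₀α : α₀ ≤ α) (hαα₁ : α ≤ α₁)
    (f : ℝ → Bardina.Field) (hf : Bardina.MemLinfH L f)
    (u : ℝ → Bardina.Field) (hu : Bardina.IsBardinaSolution L ν α f u)
    (hMA : √(Bardina.normSq L 0 (u 0)) ≤ MA) (hMB : √(Bardina.normSq L 1 (u 0)) ≤ MB)
    (T₀ T₁ β η : ℝ) (N : ℕ) (w : ℝ → Bardina.Field) (hT₀ : 0 ≤ T₀) (hη : 0 < η)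
    (hw : Bardina.IsNudgedSolution L ν β η N f u (Icc T₀ T₁) w)
    (hηN : η ≤ 2 * ν * Bardina.lam1 L * N ^ 2) :
    ∀ s ∈ Icc T₀ T₁, Bardina.normSq L 0 (w s) + β ^ 2 * Bardina.normSq L 1 (w s) ≤
      Bardina.M4sq L ν α₀ α₁ MA MB f T₀ β (w T₀) s η := by
  intro s hs
  have huE : ∀ r ∈ Icc T₀ s, Bardina.energy L β (u r) ≤
      (2 + β ^ 2 / α₀ ^ 2) * Bardina.M1sq L ν α₁ MA MB f T₀ := fun r hr => by
    have hnonneg := Bardina.energy_nonneg hL α₀ (u r)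
    calc Bardina.energy L β (u r)
        ≤ (1 + β ^ 2 / α₀ ^ 2) * Bardina.energy L α₀ (u r) :=
          Bardina.energy_le_mul_energy hL hα₀.ne' β (u r)
      _ ≤ (2 + β ^ 2 / α₀ ^ 2) * Bardina.energy L α (u r) := by
          gcongr
          exacts [one_le_two, Bardina.energy_mono hL hα₀.le hα₀α _]
      _ ≤ _ := by
          gcongr
          exact hu.energy_le_M1sq hL hν (hα₀.le.trans hα₀α) hαα₁ hf hMA hMB hT₀ hr.1
  have hws : Bardina.IsNudgedSolution L ν β η N f u (Icc T₀ s) w :=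
    Bardina.IsSolution.mono hw (Icc_subset_Icc_right hs.2)
  have henergy := hws.energy_le hL hν.le hη hηN hf hT₀ hs.1
    (fun r hr => Bardina.IsSolution.mem_V hu r (hT₀.trans hr.1)) huE
  unfold Bardina.M4sq
  unfold Bardina.energy at henergy
  linarith

/-- The length scale `α` lies in `[α₀, α₁]`, `u` solves the simplified Bardina system, and
`w n` solves the nudged system of the step `n ≥ 1` on `[t n, t (n+1)]`, starting from
`w (n-1) (t n)`; for `n = 1` this is the prescribed initial datum. -/
theorem proposition5p4
    (L ν α α₀ α₁ MA MB : ℝ) (hL : 0 < L) (hν : 0 < ν)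
    (hα₀ : 0 < α₀) (hα₀α : α₀ ≤ α) (hαα₁ : α ≤ α₁)
    (f : ℝ → Bardina.Field) (hf : Bardina.MemLinfH L f)
    (u : ℝ → Bardina.Field) (hu : Bardina.IsBardinaSolution L ν α f u)
    (hMA : Real.sqrt (Bardina.normSq L 0 (u 0)) ≤ MA)
    (hMB : Real.sqrt (Bardina.normSq L 1 (u 0)) ≤ MB)
    (t β η : ℕ → ℝ) (N : ℕ → ℕ) (w : ℕ → ℝ → Bardina.Field)
    (n : ℕ) (hn : 1 ≤ n) (ht₀ : 0 ≤ t n) (ht : t n < t (n + 1))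
    (hβ : 0 < β n) (hη : 0 < η n) (hN : 1 ≤ N n)
    (hw : Bardina.IsNudgedSolution L ν (β n) (η n) (N n) f u (Set.Icc (t n) (t (n + 1))) (w n))
    (hinit : w n (t n) = w (n - 1) (t n))
    (hcond : η n / (N n : ℝ) ^ 2 ≤ ν * Bardina.lam1 L / 2) :
    ∀ s ∈ Set.Icc (t n) (t (n + 1)),
      Bardina.normSq L 0 (w n s) + β n ^ 2 * Bardina.normSq L 1 (w n s) ≤
        Bardina.M4sq L ν α₀ α₁ MA MB f (t n) (β n) (w (n - 1) (t n)) s (η n) := by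
  have hN_pos : (0 : ℝ) < N n ^ 2 := by positivity
  have hηN : η n ≤ 2 * ν * Bardina.lam1 L * N n ^ 2 := by
    rw [div_le_iff₀ hN_pos] at hcond
    have : 0 ≤ ν * Bardina.lam1 L * N n ^ 2 := by have := Bardina.lam1_pos hL; positivity
    linarith
  rw [← hinit]
  exact proposition5p4_general L ν α α₀ α₁ MA MB hL hν hα₀ hα₀α hαα₁ f hf u hu hMA hMB
    (t n) (t (n + 1)) (β n) (η n) (N n) (w n) ht₀ hη hw hηN
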